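/- Let $\mathbb{F}$ be a finite field and $n\ge 0$. Write $\mathbb{F}^n[[z,z^{-1}]]=(\mathbb{F}^n)^{\mathbb{Z}}$ for the space of two-sided sequences $w=\sum_{i\in\mathbb{Z}}w_iz^i$ with $w_i\in\mathbb{F}^n$, with the topology of the metric $d(v,w)=\sum_{i\in\mathbb{Z}}2^{-|i|}d_H(v_i,w_i)$, where $d_H$ is the Hamming distance on $\mathbb{F}^n$. Let $\sigma$ be the left shift, $(\sigma w)_i=w_{i+1}$. For a subset $\mathcal{C}\subset\mathbb{F}^n[[z,z^{-1}]]$, a block of $\mathcal{C}$ is a finite word $x_1\cdots x_r$ over the alphabet $\mathbb{F}^n$ such that $x_1\cdots x_r=w_jw_{j+1}\cdots w_{j+r-1}$ for some $w\in\mathcal{C}$ and $j\in\mathbb{Z}$. Call $\mathcal{C}$ irreducible if for every ordered pair $\beta,\gamma$ of blocks of $\mathcal{C}$ there is a finite (possibly empty) word $\mu$ such that $\beta\mu\gamma$ is a block of $\mathcal{C}$, and shift-invariant if $\sigma(\mathcal{C})=\mathcal{C}$. For an $n\times k$ matrix $G$ over the Laurent polynomial ring $\mathbb{F}[z,z^{-1}]$,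 let $G(\sigma):\mathbb{F}^k[[z,z^{-1}]]\to\mathbb{F}^n[[z,z^{-1}]]$ be the map obtained by substituting $\sigma$ for $z$: $(G(\sigma)m)_t=\sum_{j}G_j\,m_{t+j}$ for $G=\sum_jG_jz^j$. **Theorem.** A subset $\mathcal{C}\subset\mathbb{F}^n[[z,z^{-1}]]$ is an $\mathbb{F}$-linear subspace that is compact, irreducible and shift-invariant if and only if there are $k\ge 0$ and an $n\times k$ matrix $G$ over $\mathbb{F}[z,z^{-1}]$ such that $$\mathcal{C}=\{\,G(\sigma)m \mid m\in\mathbb{F}^k[[z,z^{-1}]]\,\}.$$ -/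

import Mathlib

open scoped LaurentPolynomial

namespace ConvCode

/-- The two-sided sequence space `(Fⁿ)^ℤ = Fⁿ[[z, z⁻¹]]`: the series `∑ wᵢ zⁱ` is the
sequence `i ↦ wᵢ` of its coefficients. -/
def BiSeq (F : Type*) (n : ℕ) : Type _ := ℤ → Fin n → F

instance BiSeq.instAddCommGroup (F : Type*) [Field F] (n : ℕ) : AddCommGroup (BiSeq F n) :=
  inferInstanceAs (AddCommGroup (ℤ → Fin n → F))

instance BiSeq.instModule (F : Type*) [Field F] (n : ℕ) : Module F (BiSeq F n) :=
  inferInstanceAs (Module F (ℤ → Fin n → F))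

open Classical in
/-- The distance `d(v, w) = ∑_{i ∈ ℤ} 2^{-|i|} d_H(vᵢ, wᵢ)`, with `d_H` the Hamming distance
on `Fⁿ`. -/
noncomputable def seqDist {F : Type*} {n : ℕ} (v w : BiSeq F n) : ℝ :=
  ∑' i : ℤ, (1 / 2 : ℝ) ^ i.natAbs * (hammingDist (v i) (w i) : ℝ)

theorem summable_half_pow_natAbs : Summable fun i : ℤ => (1 / 2 : ℝ) ^ i.natAbs := by
  refine Summable.of_nat_of_neg ?_ ?_ <;>
  · simpa using summable_geometric_of_lt_one (r := (1 / 2 : ℝ)) (by norm_num) (by norm_num)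

open Classical in
theorem summable_seqDist {F : Type*} {n : ℕ} (v w : BiSeq F n) :
    Summable fun i : ℤ => (1 / 2 : ℝ) ^ i.natAbs * (hammingDist (v i) (w i) : ℝ) := by
  refine Summable.of_nonneg_of_le (fun i => by positivity) (fun i => ?_)
    (summable_half_pow_natAbs.mul_right (n : ℝ))
  gcongr
  simpa using (hammingDist_le_card_fintype (x := v i) (y := w i))

/-- The metric on `Fⁿ[[z, z⁻¹]]`; all topological notions refer to it. -/
noncomputable instance BiSeq.instMetricSpace (F : Type*) (n : ℕ) : MetricSpace (BiSeq F n) where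
  dist := seqDist
  dist_self v := by simp [seqDist]
  dist_comm v w := by simp only [seqDist, hammingDist_comm]
  dist_triangle u v w := by
    classical
    unfold seqDist
    rw [← (summable_seqDist u v).tsum_add (summable_seqDist v w)]
    refine (summable_seqDist u w).tsum_le_tsum (fun i => ?_)
      ((summable_seqDist u v).add (summable_seqDist v w))
    rw [← mul_add]
    gcongr
    exact_mod_cast hammingDist_triangle (u i) (v i) (w i)
  eq_of_dist_eq_zero {v w} h := by
    classical
    have h0 := (summable_seqDist v w).hasSum
    rw [show (∑' i : ℤ, (1 / 2 : ℝ) ^ i.natAbs * (hammingDist (v i) (w i) : ℝ)) = 0 from h,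
      hasSum_zero_iff_of_nonneg (fun i => by positivity)] at h0
    funext i
    simpa using congrFun h0 i

/-- The left shift `σ`, multiplication by `z⁻¹`: `(σ w)ₜ = wₜ₊₁`, an automorphism of the space
of two-sided sequences in an `F`-vector space `V`. For `V = F` it is `σ`, for `V = Fⁿ` it is the
coordinatewise shift `σ Iₙ`. -/
def shift (F V : Type*) [Field F] [AddCommGroup V] [Module F V] : (ℤ → V) ≃ₗ[F] (ℤ → V) :=
  LinearEquiv.funCongrLeft F V (Equiv.addRight (1 : ℤ))

/-- The operator `p(σ) = ∑ⱼ pⱼ σʲ` on `F[[z, z⁻¹]]` for a Laurent polynomial `p = ∑ⱼ pⱼ zʲ`. -/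
noncomputable def polyShift {F : Type*} [Field F] (p : F[T;T⁻¹]) : (ℤ → F) →ₗ[F] (ℤ → F) :=
  ∑ j ∈ p.coeff.support, p.coeff j • ((shift F F ^ j : (ℤ → F) ≃ₗ[F] (ℤ → F)) : (ℤ → F) →ₗ[F] (ℤ → F))

/-- The encoding map `m ↦ G(σ) m` from `Fᵏ[[z, z⁻¹]]` to `Fⁿ[[z, z⁻¹]]`: the `i`-th coordinate
sequence of `G(σ) m` is `∑ₗ Gᵢₗ(σ) mₗ`. -/
noncomputable def encodingMap {F : Type*} [Field F] {n k : ℕ}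
    (G : Matrix (Fin n) (Fin k) F[T;T⁻¹]) (m : BiSeq F k) : BiSeq F n :=
  fun t i => (∑ l : Fin k, polyShift (G i l) (fun s => m s l)) t

/-- `C` is an `F`-linear subspace. -/
def IsLinear {F : Type*} [Field F] {n : ℕ} (C : Set (BiSeq F n)) : Prop :=
  ∃ S : Submodule F (BiSeq F n), (S : Set (BiSeq F n)) = C

/-- `C` is invariant under the shift: `σ(C) = C`. -/
def IsShiftInvariant {F : Type*} [Field F] {n : ℕ} (C : Set (BiSeq F n)) : Prop :=
  (fun w : BiSeq F n => (shift F (Fin n → F) w : BiSeq F n)) '' C = C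

/-- The block (finite word) `β` occurs in the sequence `w`. -/
def Occurs {F : Type*} {n : ℕ} (β : List (Fin n → F)) (w : BiSeq F n) : Prop :=
  ∃ j : ℤ, ∀ (i : ℕ) (hi : i < β.length), w (j + i) = β[i]

/-- The set of blocks that occur in some element of `C`. -/
def blocks {F : Type*} {n : ℕ} (C : Set (BiSeq F n)) : Set (List (Fin n → F)) :=
  {β | ∃ w ∈ C, Occurs β w}

/-- Any two blocks of `C`, in either order, can be joined by a third to a block of `C`. -/
def IsIrreducible {F : Type*} {n : ℕ} (C : Set (BiSeq F n)) : Prop :=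
  ∀ β ∈ blocks C, ∀ γ ∈ blocks C, ∃ μ : List (Fin n → F), β ++ μ ++ γ ∈ blocks C

/-- A convolutional code in the sense of symbolic dynamics. -/
structure IsConvolutionalCode {F : Type*} [Field F] {n : ℕ} (C : Set (BiSeq F n)) : Prop where
  linear : IsLinear C
  compact : IsCompact C
  irreducible : IsIrreducible C
  shiftInvariant : IsShiftInvariant C

end ConvCode

/-!
The image of `G(σ)` is a linear, shift-invariant and compact code, because `G(σ)` is linear,
commutes with `σ` and is continuous on a compact space. It is irreducible because an output letter
depends on a bounded window of the input (`exists_encodingMap_window`): two inputs can be spliced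
far away from the places that matter.

Conversely, let `C` be linear, compact, irreducible and shift-invariant. The finite words of `C`
form a submodule of `F[z, z⁻¹]ⁿ` (`finiteWords`), which is finitely generated since the Laurent
polynomial ring is Noetherian; let `G` have generators as its columns. Then `C` contains the image
of `G(σ)`, because it is closed and inputs of finite support are dense (`encodingMap_mem`). The
image is itself closed and contains all finite words of `C`, so that equality amounts to density of
the finite words in `C` (`exists_finite_mem_agree`). By irreducibility each window of a codeword
can be surrounded by arbitrarily long blocks of zeros, and some fixed length of such a block permits
cutting the codeword there (`exists_truncation_mem`). This last point rests on a descending chain of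
subspaces of `Fⁿ` and on compactness.
-/

namespace ConvCode

variable {F : Type*} {n k : ℕ}

/-! ### The topology of the sequence space -/

theorem eq_of_dist_lt {v w : BiSeq F n} {i : ℤ} (h : dist v w < (1 / 2 : ℝ) ^ i.natAbs) :
    v i = w i := by
  classical
  by_contra hne
  have h1 : (1 : ℝ) ≤ hammingDist (v i) (w i) := by
    exact_mod_cast Nat.one_le_iff_ne_zero.2 (by simpa [hammingDist_eq_zero] using hne)
  have h2 : (1 / 2 : ℝ) ^ i.natAbs * (hammingDist (v i) (w i) : ℝ) ≤ seqDist v w := by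
    unfold seqDist
    convert (summable_seqDist v w).le_tsum i (fun j _ => by positivity)
  have h3 : dist v w = seqDist v w := rfl
  have h4 : (0 : ℝ) < (1 / 2 : ℝ) ^ i.natAbs := by positivity
  nlinarith

theorem exists_agree_imp_dist_lt (F : Type*) (n : ℕ) {ε : ℝ} (hε : 0 < ε) :
    ∃ N : ℕ, ∀ v w : BiSeq F n, (∀ i : ℤ, i.natAbs ≤ N → v i = w i) → dist v w < ε := by
  classical
  -- The tails of `∑ n 2^{-|i|}` bound the distance of sequences that agree on a finite set.
  obtain ⟨s, hs⟩ := ((summable_half_pow_natAbs.mul_right (n : ℝ)).tsum_vanishing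
    (Metric.ball_mem_nhds (0 : ℝ) hε))
  refine ⟨s.sup Int.natAbs, fun v w h => ?_⟩
  have hs' := hs {i : ℤ | i ∉ s} (Set.disjoint_left.2 fun i hi hi' => hi hi')
  rw [tsum_subtype {i : ℤ | i ∉ s} (fun i : ℤ => (1 / 2 : ℝ) ^ i.natAbs * (n : ℝ)),
    Metric.mem_ball, Real.dist_eq, sub_zero] at hs'
  refine lt_of_le_of_lt ?_ (lt_of_abs_lt hs')
  change seqDist v w ≤ _
  unfold seqDist
  refine (summable_seqDist v w).tsum_le_tsum (fun i => ?_)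
    ((summable_half_pow_natAbs.mul_right (n : ℝ)).indicator _)
  by_cases hi : i ∈ s
  · simp [h i (Finset.le_sup (f := Int.natAbs) hi), hi]
  · rw [Set.indicator_of_mem (by exact hi)]
    gcongr
    simpa using (hammingDist_le_card_fintype (x := v i) (y := w i))

theorem isClosed_setOf_apply_eq (i : ℤ) (a : Fin n → F) : IsClosed {v : BiSeq F n | v i = a} := by
  rw [← isOpen_compl_iff, Metric.isOpen_iff]
  refine fun v hv => ⟨(1 / 2 : ℝ) ^ i.natAbs, by positivity, fun w hw hwa => hv ?_⟩
  exact (eq_of_dist_lt (Metric.mem_ball.1 hw)).symm.trans hwa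

theorem mem_of_forall_exists_agree {C : Set (BiSeq F n)} (hC : IsClosed C) {w : BiSeq F n}
    (h : ∀ N : ℕ, ∃ v ∈ C, ∀ i : ℤ, i.natAbs ≤ N → v i = w i) : w ∈ C := by
  rw [← hC.closure_eq, Metric.mem_closure_iff]
  intro ε hε
  obtain ⟨N, hN⟩ := exists_agree_imp_dist_lt F n hε
  obtain ⟨v, hv, hvw⟩ := h N
  exact ⟨v, hv, hN _ _ fun i hi => (hvw i hi).symm⟩

/-- Compactness as an extension principle: values prescribed on a set of places are attained
by an element of a compact set as soon as they are attained on each finite window. -/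
theorem exists_mem_eqOn_of_isCompact {C : Set (BiSeq F n)} (hC : IsCompact C) (S : Set ℤ)
    (f : BiSeq F n) (h : ∀ N : ℕ, ∃ v ∈ C, ∀ i ∈ S, i.natAbs ≤ N → v i = f i) :
    ∃ v ∈ C, ∀ i ∈ S, v i = f i := by
  have hcl (N : ℕ) : IsClosed {v : BiSeq F n | ∀ i ∈ S, i.natAbs ≤ N → v i = f i} := by
    simp only [Set.ofPred_forall]
    exact isClosed_iInter fun i => isClosed_iInter fun _ => isClosed_iInter fun _ =>
      isClosed_setOf_apply_eq i (f i)
  obtain ⟨v, hv⟩ := IsCompact.nonempty_iInter_of_sequence_nonempty_isCompact_isClosed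
    (fun N : ℕ => C ∩ {v : BiSeq F n | ∀ i ∈ S, i.natAbs ≤ N → v i = f i})
    (fun N v hv => ⟨hv.1, fun i hi hiN => hv.2 i hi (by omega)⟩)
    (fun N => h N) (hC.inter_right (hcl 0)) (fun N => hC.isClosed.inter (hcl N))
  rw [Set.mem_iInter] at hv
  exact ⟨v, (hv 0).1, fun i hi => (hv i.natAbs).2 i hi le_rfl⟩

instance BiSeq.instCompactSpace [Finite F] : CompactSpace (BiSeq F n) := by
  -- The space is a continuous image of the product of the finite discrete alphabets.
  let _ : TopologicalSpace (Fin n → F) := ⊥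
  have : DiscreteTopology (Fin n → F) := ⟨rfl⟩
  let e : (ℤ → Fin n → F) → BiSeq F n := fun w => w
  have he : Continuous e := by
    rw [continuous_iff_continuousAt]
    intro w
    rw [ContinuousAt, Metric.tendsto_nhds]
    intro ε hε
    obtain ⟨N, hN⟩ := exists_agree_imp_dist_lt F n hε
    have h1 : ∀ᶠ v in nhds w, ∀ i ∈ Finset.Icc (-N : ℤ) N, v i = w i := by
      rw [Finset.eventually_all]
      intro i _
      exact (continuous_apply i).continuousAt.eventually_mem
        ((isOpen_discrete {w i}).mem_nhds rfl)
    filter_upwards [h1] with v hv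
    exact hN _ _ fun i hi => hv i (Finset.mem_Icc.2 (by omega))
  have hs : Function.Surjective e := fun w => ⟨w, rfl⟩
  exact hs.compactSpace he

/-! ### Words -/

/-- The word `β` occurs in `w` from place `j` on. -/
def OccursAt (β : List (Fin n → F)) (w : BiSeq F n) (j : ℤ) : Prop :=
  ∀ (i : ℕ) (hi : i < β.length), w (j + i) = β[i]

theorem occursAt_append {β γ : List (Fin n → F)} {w : BiSeq F n} {j : ℤ} :
    OccursAt (β ++ γ) w j ↔ OccursAt β w j ∧ OccursAt γ w (j + β.length) := by
  constructor
  · refine fun h => ⟨fun i hi => ?_, fun i hi => ?_⟩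
    · rw [h i (by simp; omega), List.getElem_append_left hi]
    · have := h (β.length + i) (by simp; omega)
      rw [List.getElem_append_right (by omega)] at this
      simpa [add_assoc] using this
  · rintro ⟨h1, h2⟩ i hi
    rcases lt_or_ge i β.length with hlt | hge
    · rw [h1 i hlt, List.getElem_append_left hlt]
    · rw [List.getElem_append_right hge, ← h2 (i - β.length) (by simp at hi; omega)]
      congr 1
      omega

theorem occursAt_ofFn {L : ℕ} {f : Fin L → Fin n → F} {w : BiSeq F n} {j : ℤ} :
    OccursAt (List.ofFn f) w j ↔ ∀ a : Fin L, w (j + (a : ℕ)) = f a := by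
  simp [OccursAt, Fin.forall_iff]

variable [Field F]

theorem BiSeq.sum_apply {ι : Type*} (S : Finset ι) (f : ι → BiSeq F n) (t : ℤ) :
    (∑ x ∈ S, f x) t = ∑ x ∈ S, f x t :=
  Finset.sum_apply (M := fun _ => Fin n → F) t S f

/-! ### Translations and the encoding map -/

/-- The power `σʲ` of the shift, `(σʲ w)ₜ = wₜ₊ⱼ`. -/
def translate (j : ℤ) : BiSeq F n →ₗ[F] BiSeq F n where
  toFun w := fun t => w (t + j)
  map_add' _ _ := rfl
  map_smul' _ _ := rfl

theorem shift_zpow_apply (j : ℤ) (f : ℤ → F) (t : ℤ) : (shift F F ^ j) f t = f (t + j) := by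
  have h1 (f : ℤ → F) (t : ℤ) : (shift F F) f t = f (t + 1) := rfl
  have h2 (f : ℤ → F) (t : ℤ) : (shift F F)⁻¹ f t = f (t - 1) := by
    have h := h1 ((shift F F)⁻¹ f) (t - 1)
    rw [sub_add_cancel] at h
    rw [← h]
    exact congrFun ((shift F F).apply_symm_apply f) (t - 1)
  induction j generalizing f t with
  | zero => simp
  | succ j ih => rw [zpow_add_one, LinearEquiv.mul_apply, ih, h1, add_assoc]
  | pred j ih => rw [zpow_sub_one, LinearEquiv.mul_apply, ih, h2, add_sub_assoc]

theorem polyShift_apply (p : F[T;T⁻¹]) (f : ℤ → F) (t : ℤ) :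
    polyShift p f t = ∑ j ∈ p.coeff.support, p.coeff j * f (t + j) := by
  simp [polyShift, shift_zpow_apply]

theorem encodingMap_apply (G : Matrix (Fin n) (Fin k) F[T;T⁻¹]) (m : BiSeq F k) (t : ℤ)
    (i : Fin n) : encodingMap G m t i =
      ∑ l, ∑ j ∈ (G i l).coeff.support, (G i l).coeff j * m (t + j) l := by
  simp [encodingMap, polyShift_apply]

/-- The encoding map `m ↦ G(σ) m` as an `F`-linear map. -/
noncomputable def encodingLinearMap (G : Matrix (Fin n) (Fin k) F[T;T⁻¹]) :
    BiSeq F k →ₗ[F] BiSeq F n where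
  toFun := encodingMap G
  map_add' m m' := by
    funext t i
    change _ = encodingMap G m t i + encodingMap G m' t i
    simp only [encodingMap_apply, ← Finset.sum_add_distrib, ← mul_add]
    rfl
  map_smul' c m := by
    funext t i
    change _ = c * encodingMap G m t i
    simp only [encodingMap_apply, Finset.mul_sum, mul_left_comm c]
    rfl

theorem encodingMap_translate (G : Matrix (Fin n) (Fin k) F[T;T⁻¹]) (j : ℤ) (m : BiSeq F k) :
    encodingMap G (translate j m) = translate j (encodingMap G m) := by
  funext t i
  change _ = encodingMap G m (t + j) i
  simp only [encodingMap_apply, add_right_comm t j]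
  rfl

/-- `G(σ)` is a sliding block map: each output letter depends on a window of bounded radius. -/
theorem exists_encodingMap_window (G : Matrix (Fin n) (Fin k) F[T;T⁻¹]) :
    ∃ R : ℕ, ∀ (m m' : BiSeq F k) (t : ℤ), (∀ s, t - R ≤ s → s ≤ t + R → m s = m' s) →
      encodingMap G m t = encodingMap G m' t := by
  refine ⟨Finset.univ.sup fun i => Finset.univ.sup fun l => (G i l).coeff.support.sup Int.natAbs,
    fun m m' t h => ?_⟩
  funext i
  rw [encodingMap_apply, encodingMap_apply]
  refine Finset.sum_congr rfl fun l _ => Finset.sum_congr rfl fun j hj => ?_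
  have h1 : j.natAbs ≤ Finset.univ.sup fun i => Finset.univ.sup fun l =>
      (G i l).coeff.support.sup Int.natAbs :=
    (Finset.le_sup (f := Int.natAbs) hj).trans
      ((Finset.le_sup (f := fun l => (G i l).coeff.support.sup Int.natAbs)
        (Finset.mem_univ l)).trans
      (Finset.le_sup (f := fun i => Finset.univ.sup fun l =>
        (G i l).coeff.support.sup Int.natAbs) (Finset.mem_univ i)))
  rw [h (t + j) (by omega) (by omega)]

theorem continuous_encodingMap (G : Matrix (Fin n) (Fin k) F[T;T⁻¹]) :
    Continuous (encodingMap G) := by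
  obtain ⟨R, hR⟩ := exists_encodingMap_window G
  rw [Metric.continuous_iff]
  intro m ε hε
  obtain ⟨N, hN⟩ := exists_agree_imp_dist_lt F n hε
  refine ⟨(1 / 2 : ℝ) ^ (N + R), by positivity, fun m' hm' => hN _ _ fun i hi => ?_⟩
  refine hR _ _ _ fun s hs hs' => eq_of_dist_lt (hm'.trans_le ?_)
  exact pow_le_pow_of_le_one (by norm_num) (by norm_num) (by omega)

theorem isCompact_range_encodingMap [Finite F] (G : Matrix (Fin n) (Fin k) F[T;T⁻¹]) :
    IsCompact (Set.range (encodingMap G)) :=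
  isCompact_range (continuous_encodingMap G)

theorem isIrreducible_range_encodingMap (G : Matrix (Fin n) (Fin k) F[T;T⁻¹]) :
    IsIrreducible (Set.range (encodingMap G)) := by
  rintro β ⟨_, ⟨m, rfl⟩, j, hβ⟩ γ ⟨_, ⟨m', rfl⟩, j', hγ⟩
  obtain ⟨R, hR⟩ := exists_encodingMap_window G
  -- Switch from `m` to a translate of `m'` in the middle of a gap of length `2 R`.
  let m'' : BiSeq F k := fun t =>
    if t < j + β.length + R then m t else translate (j' - (j + β.length + 2 * R)) m' t
  refine ⟨List.ofFn fun a : Fin (2 * R) => encodingMap G m'' (j + β.length + (a : ℕ)),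
    _, ⟨m'', rfl⟩, j, ?_⟩
  change OccursAt _ _ _
  rw [occursAt_append, occursAt_append]
  refine ⟨⟨fun i hi => ?_, occursAt_ofFn.2 fun a => rfl⟩, fun i hi => ?_⟩
  · rw [← hβ i hi]
    exact hR _ _ _ fun s hs hs' => if_pos (by omega)
  · rw [← hγ i hi, hR m'' (translate (j' - (j + β.length + 2 * R)) m') _
      fun s hs hs' => if_neg (by simp at hs; omega), encodingMap_translate]
    change encodingMap G m' _ = _
    congr 1
    simp
    ring

/-! ### Truncation of codewords and density of the finite ones -/

/-- In a compact shift-invariant linear code there is a length `L` such that a codeword can be cut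
after any `L` consecutive zeros. The letters that can follow `L` zeros form a decreasing sequence of
subspaces of `Fⁿ`, so for large `L` they can also follow a past that is zero altogether; the future
of the given codeword is then rebuilt letter by letter after the zero past. -/
theorem exists_truncation_mem {D : Submodule F (BiSeq F n)}
    (hD : IsCompact (D : Set (BiSeq F n))) (hσ : ∀ j, ∀ w ∈ D, translate j w ∈ D) :
    ∃ L : ℕ, ∀ w ∈ D, ∀ a : ℤ, (∀ i, a - L < i → i ≤ a → w i = 0) →
      (fun t => if a < t then w t else 0 : BiSeq F n) ∈ D := by
  -- `B L` consists of the letters that can follow `L` zeros.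
  let B (L : ℕ) : Submodule F (Fin n → F) :=
    { carrier := {b | ∃ w ∈ D, (∀ i : ℤ, -(L : ℤ) < i → i ≤ 0 → w i = 0) ∧ w 1 = b}
      zero_mem' := ⟨0, D.zero_mem, fun _ _ _ => rfl, rfl⟩
      add_mem' := by
        rintro _ _ ⟨v, hv, hv0, rfl⟩ ⟨w, hw, hw0, rfl⟩
        refine ⟨v + w, D.add_mem hv hw, fun i hi hi' => ?_, rfl⟩
        change v i + w i = 0
        rw [hv0 i hi hi', hw0 i hi hi', add_zero]
      smul_mem' := by
        rintro c _ ⟨v, hv, hv0, rfl⟩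
        refine ⟨c • v, D.smul_mem c hv, fun i hi hi' => ?_, rfl⟩
        change c • v i = 0
        rw [hv0 i hi hi', smul_zero] }
  obtain ⟨L, hL⟩ := IsArtinian.monotone_stabilizes (R := F) (M := Fin n → F)
    ⟨fun L => OrderDual.toDual (B L), fun L L' h => by
      rintro b ⟨w, hw, hw0, hb⟩
      exact ⟨w, hw, fun i hi hi' => hw0 i (by omega) hi', hb⟩⟩
  refine ⟨L, fun w hw a ha => ?_⟩
  -- By compactness, the next letter of `u` can also follow a past that is zero altogether.
  have step (u : BiSeq F n) (hu : u ∈ D) (c : ℤ) (hc : ∀ i, c - L < i → i ≤ c → u i = 0) :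
      ∃ v ∈ D, (∀ i ≤ c, v i = 0) ∧ v (c + 1) = u (c + 1) := by
    have hmem (M : ℕ) (hM : L ≤ M) : u (c + 1) ∈ B M := by
      have h1 : B L = B M := hL M hM
      rw [← h1]
      refine ⟨translate c u, hσ c u hu, fun i hi hi' => hc _ (by omega) (by omega), ?_⟩
      change u (1 + c) = _
      rw [add_comm]
    obtain ⟨v, hv, hv'⟩ := exists_mem_eqOn_of_isCompact hD {i | i ≤ 1}
      (fun i => if i ≤ 0 then 0 else u (c + 1)) (fun N => by
        obtain ⟨v, hv, hv0, hv1⟩ := hmem (max L (N + 1)) (le_max_left _ _)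
        refine ⟨v, hv, fun i hi hiN => ?_⟩
        have hi : i ≤ 1 := hi
        split_ifs with h
        · exact hv0 i (by omega) h
        · obtain rfl : i = 1 := by omega
          exact hv1)
    refine ⟨translate (-c) v, hσ _ v hv, fun i hi => ?_, ?_⟩
    · change v (i + -c) = 0
      rw [hv' _ (show i + -c ≤ 1 by omega), if_pos (by omega)]
    · change v (c + 1 + -c) = _
      rw [hv' _ (show c + 1 + -c ≤ 1 by omega), if_neg (by omega)]
  -- Subtracting what has been rebuilt from `w` leaves a codeword with a longer run of zeros, to which
  -- `step` applies again.
  have fin (M : ℕ) : ∃ v ∈ D, (∀ i ≤ a, v i = 0) ∧ ∀ i, a < i → i ≤ a + M → v i = w i := by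
    induction M with
    | zero => exact ⟨0, D.zero_mem, fun _ _ => rfl, fun i hi hi' => by simp at hi'; omega⟩
    | succ M ih =>
      obtain ⟨v, hv, hv0, hvw⟩ := ih
      obtain ⟨x, hx, hx0, hx1⟩ := step (w - v) (D.sub_mem hw hv) (a + M) (fun i hi hi' => by
        change w i - v i = 0
        rcases lt_or_ge a i with h | h
        · rw [hvw i h hi', sub_self]
        · rw [ha i (by omega) h, hv0 i h, sub_zero])
      refine ⟨v + x, D.add_mem hv hx, fun i hi => ?_, fun i hi hi' => ?_⟩
      · change v i + x i = 0
        rw [hv0 i hi, hx0 i (by omega), add_zero]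
      · change v i + x i = w i
        rcases lt_or_ge (a + M : ℤ) i with h | h
        · obtain rfl : i = a + M + 1 := by push_cast at hi'; omega
          rw [hx1]
          exact add_sub_cancel (v _) (w _)
        · rw [hvw i hi h, hx0 i h, add_zero]
  refine mem_of_forall_exists_agree hD.isClosed fun N => ?_
  obtain ⟨v, hv, hv0, hvw⟩ := fin (N + a.natAbs)
  refine ⟨v, hv, fun i hi => ?_⟩
  split_ifs with h
  · exact hvw i h (by omega)
  · exact hv0 i (by omega)

/-- Finite codewords are dense: irreducibility surrounds a given window of a codeword by blocks of
zeros, and the result is cut off there on both sides. -/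
theorem exists_finite_mem_agree {D : Submodule F (BiSeq F n)}
    (hD : IsCompact (D : Set (BiSeq F n))) (hσ : ∀ j, ∀ w ∈ D, translate j w ∈ D)
    (hI : IsIrreducible (D : Set (BiSeq F n))) {w : BiSeq F n} (hw : w ∈ D) (N : ℕ) :
    ∃ v ∈ D, (∀ i : ℤ, i.natAbs ≤ N → v i = w i) ∧ ∃ M : ℕ, ∀ i : ℤ, M < i.natAbs → v i = 0 := by
  obtain ⟨L, hL⟩ := exists_truncation_mem hD hσ
  have hz : List.ofFn (fun _ : Fin L => (0 : Fin n → F)) ∈ blocks (D : Set (BiSeq F n)) :=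
    ⟨0, D.zero_mem, 0, occursAt_ofFn.2 fun _ => rfl⟩
  have hβ : List.ofFn (fun a : Fin (2 * N + 1) => w (-N + (a : ℕ))) ∈
      blocks (D : Set (BiSeq F n)) := ⟨w, hw, -N, occursAt_ofFn.2 fun _ => rfl⟩
  obtain ⟨μ, hμ⟩ := hI _ hz _ hβ
  obtain ⟨ν, x, hx, j, hj⟩ := hI _ hμ _ hz
  change OccursAt _ _ _ at hj
  simp only [occursAt_append, occursAt_ofFn, List.length_append, List.length_ofFn] at hj
  obtain ⟨⟨⟨⟨h1, -⟩, h2⟩, -⟩, h3⟩ := hj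
  -- The window starts at place `p` of `x`, and `y` is `x` with its past cut off.
  set p : ℤ := j + (L + μ.length : ℕ) with hp
  set q : ℤ := j + (L + μ.length + (2 * N + 1) + ν.length : ℕ) with hq
  let y : BiSeq F n := fun t => if j + L - 1 < t then x t else 0
  have hy : y ∈ D := hL x hx (j + L - 1) fun i hi hi' => by
    have := h1 ⟨(i - j).toNat, by omega⟩
    rwa [show j + ((i - j).toNat : ℤ) = i by omega] at this
  -- `z` is the future of `y` after the second block of zeros, so that `y - z` is finite.
  let z : BiSeq F n := fun t => if q + L - 1 < t then y t else 0
  have hzD : z ∈ D := hL y hy (q + L - 1) fun i hi hi' => by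
    have := h3 ⟨(i - q).toNat, by omega⟩
    simp only [Nat.cast_add] at this hq
    rw [show q + ((i - q).toNat : ℤ) = i by omega] at this
    simp only [y, this, ite_self]
  refine ⟨translate (p + N) (y - z), hσ _ _ (D.sub_mem hy hzD), fun i hi => ?_,
    (j.natAbs + L + q.natAbs + L + p.natAbs + N + 1), fun i hi => ?_⟩
  · change y (i + (p + N)) - z (i + (p + N)) = w i
    have := h2 ⟨(i + N).toNat, by omega⟩
    simp only [show p + ((i + N).toNat : ℤ) = i + (p + N) by omega,
      show -(N : ℤ) + ((i + N).toNat : ℤ) = i by omega] at this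
    simp only [y, z]
    rw [if_pos (by push_cast at hp; omega), if_neg (by push_cast at hp hq; omega), sub_zero, this]
  · change y (i + (p + N)) - z (i + (p + N)) = 0
    simp only [y, z]
    split_ifs <;> first | omega | simp

/-! ### Finite sequences as vectors of Laurent polynomials -/

/-- The finite sequence `G(σ) δ₀` attached to a column `g` of Laurent polynomials. As `σ` shifts to
the left, the coefficient of `zʲ` stands at place `-j`. -/
def finSeq (g : Fin n → F[T;T⁻¹]) : BiSeq F n := fun t i => (g i).coeff (-t)

theorem finSeq_add (g h : Fin n → F[T;T⁻¹]) : finSeq (g + h) = finSeq g + finSeq h := rfl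

theorem finSeq_monomial_smul (j : ℤ) (c : F) (g : Fin n → F[T;T⁻¹]) :
    finSeq ((LaurentPolynomial.C c * LaurentPolynomial.T j) • g) =
      c • translate j (finSeq g) := by
  funext t i
  change ((LaurentPolynomial.C c * LaurentPolynomial.T j) * g i).coeff (-t) =
    c * (g i).coeff (-(t + j))
  rw [← LaurentPolynomial.single_eq_C_mul_T, AddMonoidAlgebra.coeff_single_mul_apply]
  congr 2
  ring

/-- The vectors of Laurent polynomials whose sequence lies in a linear code invariant under all
translations form a module over the Laurent polynomials. -/
def finiteWords (D : Submodule F (BiSeq F n)) (hσ : ∀ j, ∀ w ∈ D, translate j w ∈ D) :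
    Submodule F[T;T⁻¹] (Fin n → F[T;T⁻¹]) where
  carrier := {g | finSeq g ∈ D}
  zero_mem' := D.zero_mem
  add_mem' hg hh := D.add_mem hg hh
  smul_mem' p g hg := by
    induction p using LaurentPolynomial.induction_on' with
    | add p q hp hq =>
      rw [add_smul]
      exact D.add_mem hp hq
    | C_mul_T j c =>
      rw [Set.mem_ofPred_eq, finSeq_monomial_smul]
      exact D.smul_mem _ (hσ _ _ hg)

theorem exists_finSeq_eq {v : BiSeq F n} {M : ℕ} (hv : ∀ i : ℤ, M < i.natAbs → v i = 0) :
    ∃ g : Fin n → F[T;T⁻¹], finSeq g = v := by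
  refine ⟨fun i => AddMonoidAlgebra.ofCoeff (Finsupp.onFinset (Finset.Icc (-M : ℤ) M)
    (fun j => v (-j) i) fun j hj => ?_), ?_⟩
  · by_contra h
    rw [Finset.mem_Icc] at h
    exact hj (by rw [hv (-j) (by omega)]; rfl)
  · funext t i
    change v (- -t) i = _
    rw [neg_neg]

instance LaurentPolynomial.instIsNoetherianRing : IsNoetherianRing F[T;T⁻¹] :=
  IsLocalization.isNoetherianRing (Submonoid.powers (Polynomial.X : Polynomial F)) _ inferInstance

/-- The input `a z^s`, with the letter `a` at place `s` and zeros elsewhere. -/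
def impulse (s : ℤ) (a : Fin k → F) : BiSeq F k := fun t => if t = s then a else 0

theorem encodingMap_impulse (G : Matrix (Fin n) (Fin k) F[T;T⁻¹]) (s : ℤ) (a : Fin k → F) :
    encodingMap G (impulse s a) = ∑ l, a l • translate (-s) (finSeq fun i => G i l) := by
  funext t i
  rw [BiSeq.sum_apply, Finset.sum_apply, encodingMap_apply]
  refine Finset.sum_congr rfl fun l _ => ?_
  change _ = a l * (G i l).coeff (-(t + -s))
  rw [Finset.sum_eq_single (-(t + -s))]
  · rw [impulse, if_pos (by ring), mul_comm]
  · intro j _ hj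
    rw [impulse, if_neg (by omega), Pi.zero_apply, mul_zero]
  · intro hj
    rw [Finsupp.notMem_support_iff.1 hj, zero_mul]

/-- A closed linear code contains the image of `G(σ)` once it contains the translates of the columns
of `G`, since inputs of finite support are dense. -/
theorem encodingMap_mem {D : Submodule F (BiSeq F n)} (hD : IsClosed (D : Set (BiSeq F n)))
    (hσ : ∀ j, ∀ w ∈ D, translate j w ∈ D) (G : Matrix (Fin n) (Fin k) F[T;T⁻¹])
    (hG : ∀ l, finSeq (fun i => G i l) ∈ D) (m : BiSeq F k) : encodingMap G m ∈ D := by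
  obtain ⟨R, hR⟩ := exists_encodingMap_window G
  refine mem_of_forall_exists_agree hD fun N => ?_
  let m' : BiSeq F k := ∑ s ∈ Finset.Icc (-(N + R : ℤ)) (N + R), impulse s (m s)
  refine ⟨encodingLinearMap G m', ?_, fun i hi => hR _ _ _ fun s hs hs' => ?_⟩
  · rw [map_sum]
    refine D.sum_mem fun s _ => ?_
    change encodingMap G _ ∈ D
    rw [encodingMap_impulse]
    exact D.sum_mem fun l _ => D.smul_mem _ (hσ _ _ (hG l))
  · refine (BiSeq.sum_apply _ _ s).trans ?_
    rw [Finset.sum_eq_single s]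
    · exact if_pos rfl
    · exact fun b _ hb => if_neg hb.symm
    · exact fun hns => absurd (Finset.mem_Icc.2 (by omega)) hns

/-! ### The two characterizations -/

theorem isConvolutionalCode_range_encodingMap [Finite F]
    (G : Matrix (Fin n) (Fin k) F[T;T⁻¹]) : IsConvolutionalCode (Set.range (encodingMap G)) where
  linear := ⟨(encodingLinearMap G).range, rfl⟩
  compact := isCompact_range_encodingMap G
  irreducible := isIrreducible_range_encodingMap G
  shiftInvariant := by
    have key (m : BiSeq F k) : (shift F (Fin n → F) (encodingMap G m) : BiSeq F n) =
      encodingMap G (translate 1 m) := (encodingMap_translate G 1 m).symm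
    ext w
    constructor
    · rintro ⟨_, ⟨m, rfl⟩, rfl⟩
      exact ⟨_, (key m).symm⟩
    · rintro ⟨m, rfl⟩
      refine ⟨_, ⟨translate (-1) m, rfl⟩, (key _).trans (congrArg _ ?_)⟩
      funext t
      exact congrArg m (add_neg_cancel_right t 1)

theorem IsShiftInvariant.translate_mem {C : Set (BiSeq F n)} (hC : IsShiftInvariant C) (j : ℤ)
    {w : BiSeq F n} (hw : w ∈ C) : translate j w ∈ C := by
  have h1 (w : BiSeq F n) (hw : w ∈ C) : translate 1 w ∈ C :=
    hC.subset ⟨w, hw, rfl⟩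
  have h2 (w : BiSeq F n) (hw : w ∈ C) : translate (-1) w ∈ C := by
    obtain ⟨v, hv, rfl⟩ := hC.superset hw
    convert hv
    funext t
    exact congrArg v (neg_add_cancel_right t 1)
  induction j with
  | zero =>
    convert hw
    funext t
    exact congrArg w (add_zero t)
  | succ j ih =>
    convert h1 _ ih using 1
    funext t
    exact congrArg w (by ring)
  | pred j ih =>
    convert h2 _ ih using 1
    funext t
    exact congrArg w (by ring)

theorem IsConvolutionalCode.exists_eq_range [Finite F] {C : Set (BiSeq F n)}
    (hC : IsConvolutionalCode C) : ∃ (k : ℕ) (G : Matrix (Fin n) (Fin k) F[T;T⁻¹]),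
      C = Set.range (encodingMap G) := by
  obtain ⟨D, rfl⟩ := hC.linear
  have hσ : ∀ j, ∀ w ∈ D, translate j w ∈ D := fun j w hw =>
    hC.shiftInvariant.translate_mem j hw
  obtain ⟨k, g, hg⟩ := Submodule.fg_iff_exists_fin_generating_family.1
    (IsNoetherian.noetherian (finiteWords D hσ))
  let G : Matrix (Fin n) (Fin k) F[T;T⁻¹] := fun i l => g l i
  refine ⟨k, G, Set.Subset.antisymm (fun w hw => ?_) ?_⟩
  -- The finite words of `D` are combinations of the columns of `G`, hence lie in the closed image.
  · have hσ' : ∀ j, ∀ w ∈ (encodingLinearMap G).range,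
        translate j w ∈ (encodingLinearMap G).range := by
      rintro j _ ⟨m, rfl⟩
      exact ⟨translate j m, encodingMap_translate G j m⟩
    have hle : finiteWords D hσ ≤ finiteWords (encodingLinearMap G).range hσ' := by
      rw [← hg, Submodule.span_le]
      rintro _ ⟨l, rfl⟩
      refine ⟨impulse 0 (Pi.single l 1), (encodingMap_impulse G 0 _).trans ?_⟩
      rw [Finset.sum_eq_single l (fun l' _ hl' => by rw [Pi.single_eq_of_ne hl', zero_smul])
        (fun h => absurd (Finset.mem_univ l) h), Pi.single_eq_same, one_smul]
      funext t
      exact congrArg (finSeq (g l)) (by simp)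
    refine mem_of_forall_exists_agree (isCompact_range_encodingMap G).isClosed fun N => ?_
    obtain ⟨v, hv, hvw, M, hM⟩ := exists_finite_mem_agree hC.compact hσ hC.irreducible hw N
    obtain ⟨h, rfl⟩ := exists_finSeq_eq hM
    exact ⟨_, hle hv, hvw⟩
  · rintro _ ⟨m, rfl⟩
    refine encodingMap_mem hC.compact.isClosed hσ G (fun l => ?_) m
    have : g l ∈ finiteWords D hσ := hg ▸ Submodule.subset_span ⟨l, rfl⟩
    exact this

end ConvCode

theorem mainTheorem6 {F : Type*} [Field F] [Finite F] (n : ℕ) (C : Set (ConvCode.BiSeq F n)) :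
    ConvCode.IsConvolutionalCode C ↔
      ∃ (k : ℕ) (G : Matrix (Fin n) (Fin k) F[T;T⁻¹]),
        C = Set.range (ConvCode.encodingMap G) := by
  constructor
  · exact fun h => h.exists_eq_range
  · rintro ⟨k, G, rfl⟩
    exact ConvCode.isConvolutionalCode_range_encodingMap G
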